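/- For integers $p,M,N\geq 1$ let $$\delta_p(M,N)=\frac{1}{(MN)^p}\,\#\left\{\begin{matrix}a_1,\ldots,a_p\in\{0,\ldots,M-1\}\\ b_1,\ldots,b_p\in\{0,\ldots,N-1\}\end{matrix}\ \Big|\ \begin{matrix}[(a_1,b_1),(a_2,b_2),\ldots,(a_p,b_p)]\\ =[(a_1,b_p),(a_2,b_1),\ldots,(a_p,b_{p-1})]\end{matrix}\right\},$$ where the brackets denote multisets (sets with repetitions). Then, for every fixed integer $N\geq 1$, $$\delta_p(2,N)\simeq\sqrt{\frac{N^N}{(\pi p)^{N-1}}}\qquad\text{as } p\to\infty,$$ where $x_p\simeq y_p$ means that $x_p/y_p\to 1$. -/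

import Mathlib

/-- The pairs of multi-indices `a ∈ {0, …, M-1}^p`, `b ∈ {0, …, N-1}^p` such that
`[(a_1, b_1), (a_2, b_2), …, (a_p, b_p)] = [(a_1, b_p), (a_2, b_1), …, (a_p, b_{p-1})]`
as multisets (sets with repetitions). Here `finRotate p` is the cyclic successor `y ↦ y + 1`
of the positions, so that its inverse is the cyclic predecessor. -/
def cyclicPairs (p M N : ℕ) : Finset ((Fin p → Fin M) × (Fin p → Fin N)) :=
  Finset.univ.filter fun ab =>
    (Finset.univ : Finset (Fin p)).val.map (fun y => (ab.1 y, ab.2 y)) =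
      (Finset.univ : Finset (Fin p)).val.map (fun y => (ab.1 y, ab.2 ((finRotate p).symm y)))

/-- The number `δ_p(M, N)`: the proportion of the pairs of multi-indices `(a, b)` that satisfy
the multiset equation of `cyclicPairs`. -/
noncomputable def limitMoment (p M N : ℕ) : ℝ :=
  ((cyclicPairs p M N).card : ℝ) / ((M : ℝ) * (N : ℝ)) ^ p

/-!
Write `N = n + 1`. The multiset equation says that, for every colour `k`, the increments
`a (y + 1) - a y` over the positions `y` with `b y = k` add up to zero
(`mem_cyclicPairs_iff`); the equation for the colour `0` follows from the others.
Detecting these equations by integration over the torus `(-π, π]ⁿ` and summing over `b` and then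
over `a` turns the count into the integral of `tr (T ^ p)`, where `T = !![N, φ; conj φ, N]` and
`φ = 1 + ∑ exp (i θ_k)`. The eigenvalues of `T` are `N (1 ± r)` with `r = |φ| / N`, so that
(`limitMoment_eq_integral`)

`δ_p(2, N) = (2π)⁻ⁿ ∫ ((1 + r) / 2) ^ p + ((1 - r) / 2) ^ p`.

The second term is at most `2⁻ᵖ`. For the first one, `r = 1` only at the origin, and the
substitution `θ = x / √p` together with dominated convergence gives a Gaussian integral
(`tendsto_sqrt_pow_mul_integral_add`). The exponent is a multiple of the variance of the vector
`(0, x_1, …, x_n)`; its integral is computed in `integral_exp_neg_pairSpread` by adding one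
Gaussian variable that plays the role of the mean.
-/

open MeasureTheory Filter Topology

/-! ### The multiset equation as a system of linear equations -/

/-- The total increment of the binary word `a` over the positions of colour `k`, where the
increment at `y` is `a (y + 1) - a y`, read cyclically. -/
def colourDrift {p N : ℕ} (a : Fin p → Fin 2) (b : Fin p → Fin N) (k : Fin N) : ℤ :=
  ∑ y, if b y = k then ((a (finRotate p y) : ℕ) : ℤ) - ((a y : ℕ) : ℤ) else 0

lemma sum_colourDrift {p N : ℕ} (a : Fin p → Fin 2) (b : Fin p → Fin N) :
    ∑ k, colourDrift a b k = 0 := by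
  unfold colourDrift
  rw [Finset.sum_comm]
  simp only [Finset.sum_ite_eq, Finset.mem_univ, if_true, Finset.sum_sub_distrib]
  rw [Equiv.sum_comp (finRotate p) (fun y => ((a y : ℕ) : ℤ)), sub_self]

/-- Reading the shifted multiset at the position following `y` moves the shift from `b` to `a`. -/
lemma count_shifted_pairs {p N : ℕ} (a : Fin p → Fin 2) (b : Fin p → Fin N)
    (i : Fin 2) (k : Fin N) :
    ((Finset.univ : Finset (Fin p)).val.map
        (fun y => (a y, b ((finRotate p).symm y)))).count (i, k) =
      ∑ y, if b y = k then (if a (finRotate p y) = i then 1 else 0) else 0 := by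
  rw [Multiset.count_map, ← Finset.filter_val, Finset.card_val, Finset.card_filter,
    ← Equiv.sum_comp (finRotate p)]
  refine Finset.sum_congr rfl fun y _ => ?_
  simp only [Equiv.symm_apply_apply, Prod.mk.injEq, eq_comm (a := i), eq_comm (a := k)]
  split_ifs <;> simp_all

lemma count_pairs {p N : ℕ} (a : Fin p → Fin 2) (b : Fin p → Fin N) (i : Fin 2) (k : Fin N) :
    ((Finset.univ : Finset (Fin p)).val.map (fun y => (a y, b y))).count (i, k) =
      ∑ y, if b y = k then (if a y = i then 1 else 0) else 0 := by
  rw [Multiset.count_map, ← Finset.filter_val, Finset.card_val, Finset.card_filter]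
  refine Finset.sum_congr rfl fun y _ => ?_
  simp only [Prod.mk.injEq, eq_comm (a := i), eq_comm (a := k)]
  split_ifs <;> simp_all

/-- The multiplicities of `(0, k)` and `(1, k)` change by opposite amounts under the shift,
because their sum is the number of positions of colour `k`. -/
lemma count_sub_count {p N : ℕ} (a : Fin p → Fin 2) (b : Fin p → Fin N)
    (i : Fin 2) (k : Fin N) :
    ((((Finset.univ : Finset (Fin p)).val.map
        (fun y => (a y, b ((finRotate p).symm y)))).count (i, k) : ℕ) : ℤ) -
      (((Finset.univ : Finset (Fin p)).val.map (fun y => (a y, b y))).count (i, k) : ℕ) =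
      if i = 0 then -colourDrift a b k else colourDrift a b k := by
  rw [count_shifted_pairs, count_pairs, colourDrift]
  push_cast
  rw [← Finset.sum_sub_distrib, ← Finset.sum_neg_distrib, ← Finset.sum_ite_irrel]
  refine Finset.sum_congr rfl fun y _ => ?_
  by_cases hb : b y = k
  · simp only [hb, if_true]
    generalize a y = u
    generalize a (finRotate p y) = v
    revert i u v
    decide
  · simp [hb]

lemma mem_cyclicPairs_iff {p N : ℕ} (a : Fin p → Fin 2) (b : Fin p → Fin N) :
    (a, b) ∈ cyclicPairs p 2 N ↔ ∀ k, colourDrift a b k = 0 := by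
  simp only [cyclicPairs, Finset.mem_filter, Finset.mem_univ, true_and]
  constructor
  · intro h k
    have := count_sub_count a b 1 k
    rw [h, sub_self] at this
    simpa using this.symm
  · intro h
    ext ⟨i, k⟩
    have := count_sub_count a b i k
    rw [h k] at this
    simp only [neg_zero, ite_self] at this
    omega

/-- One of the equations is redundant, since the drifts add up to zero. -/
lemma mem_cyclicPairs_iff_succ {p n : ℕ} (a : Fin p → Fin 2) (b : Fin p → Fin (n + 1)) :
    (a, b) ∈ cyclicPairs p 2 (n + 1) ↔ ∀ k : Fin n, colourDrift a b k.succ = 0 := by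
  rw [mem_cyclicPairs_iff]
  refine ⟨fun h k => h _, fun h k => ?_⟩
  have hs := sum_colourDrift a b
  rw [Fin.sum_univ_succ, Finset.sum_eq_zero fun i _ => h i, add_zero] at hs
  exact Fin.cases hs h k

/-! ### Cyclic words and traces of matrix powers -/

lemma sum_prod_path_eq_pow {ι R : Type*} [Fintype ι] [DecidableEq ι] [CommSemiring R]
    (T : Matrix ι ι R) (m : ℕ) (i j : ι) :
    ∑ a : Fin m → ι, ∏ y : Fin (m + 1),
        T (Fin.cons (α := fun _ => ι) i a y) (Fin.snoc (α := fun _ => ι) a j y) =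
      (T ^ (m + 1)) i j := by
  induction m generalizing i with
  | zero => simp [Fin.snoc]
  | succ m ih =>
    rw [pow_succ', Matrix.mul_apply, ← (Fin.consEquiv fun _ => ι).sum_comp,
      Fintype.sum_prod_type]
    refine Finset.sum_congr rfl fun k _ => ?_
    rw [← ih k, Finset.mul_sum]
    refine Finset.sum_congr rfl fun a _ => ?_
    have hs : Fin.snoc (α := fun _ => ι) ((Fin.consEquiv fun _ => ι) (k, a)) j =
        Fin.cons (α := fun _ => ι) k (Fin.snoc (α := fun _ => ι) a j) :=
      (Fin.cons_snoc_eq_snoc_cons (β := ι) k a j).symm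
    rw [Fin.prod_univ_succ, hs]
    simp only [Fin.consEquiv_apply, Fin.cons_zero, Fin.cons_succ]

lemma sum_prod_cycle_eq_trace {ι R : Type*} [Fintype ι] [DecidableEq ι] [CommSemiring R]
    (T : Matrix ι ι R) (m : ℕ) :
    ∑ a : Fin (m + 1) → ι, ∏ y, T (a y) (a (finRotate (m + 1) y)) = (T ^ (m + 1)).trace := by
  rw [Matrix.trace, ← (Fin.consEquiv fun _ => ι).sum_comp, Fintype.sum_prod_type]
  refine Finset.sum_congr rfl fun i _ => ?_
  rw [Matrix.diag_apply, ← sum_prod_path_eq_pow]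
  simp only [Fin.snoc_eq_cons_rotate, Fin.consEquiv_apply]

/-- The power sums of the eigenvalues `c ± r` of a two by two matrix with constant diagonal. -/
lemma trace_pow_fin_two {R : Type*} [CommRing R] (c u v r : R) (h : u * v = r ^ 2) (m : ℕ) :
    ((!![c, u; v, c] : Matrix (Fin 2) (Fin 2) R) ^ m).trace = (c + r) ^ m + (c - r) ^ m := by
  induction m using Nat.twoStepInduction with
  | zero => simp [one_add_one_eq_two]
  | one => simp [Matrix.trace_fin_two]
  | more m ih0 ih1 =>
    have key : (!![c, u; v, c] : Matrix (Fin 2) (Fin 2) R) ^ 2 =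
        (2 * c) • !![c, u; v, c] - (c ^ 2 - r ^ 2) • 1 := by
      rw [← h]
      ext i j
      fin_cases i <;> fin_cases j <;> simp [pow_two, Matrix.mul_apply, Fin.sum_univ_two] <;> ring
    rw [pow_add, key, mul_sub, Matrix.mul_smul, Matrix.mul_smul, mul_one, ← pow_succ,
      Matrix.trace_sub, Matrix.trace_smul, Matrix.trace_smul, ih0, ih1]
    simp only [smul_eq_mul]
    ring

/-! ### Fourier representation of the number of solutions -/

/-- The vector of angles `θ`, extended by the angle `0` for the colour `0`. -/
def anchored {n : ℕ} (θ : Fin n → ℝ) : Fin (n + 1) → ℝ := Fin.cons 0 θ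

/-- The modulus `r(θ)` of the mean of the phases `exp (i θ_k)`, the angle of colour `0` being `0`. -/
noncomputable def meanPhaseNorm {n : ℕ} (θ : Fin n → ℝ) : ℝ :=
  ‖∑ k, Complex.exp (anchored θ k * Complex.I)‖ / (n + 1 : ℕ)

/-- The fundamental box `(-π, π]ⁿ` of the torus. -/
def angleBox (n : ℕ) : Set (Fin n → ℝ) := Set.univ.pi fun _ => Set.Ioc (-Real.pi) Real.pi

lemma measurableSet_angleBox (n : ℕ) : MeasurableSet (angleBox n) :=
  MeasurableSet.univ_pi fun _ => measurableSet_Ioc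

lemma volume_angleBox_lt_top (n : ℕ) : volume (angleBox n) < ⊤ := by
  rw [angleBox, Real.volume_pi_Ioc]
  exact ENNReal.prod_lt_top fun _ _ => ENNReal.ofReal_lt_top

lemma integrableOn_angleBox {n : ℕ} {E : Type*} [NormedAddCommGroup E] {f : (Fin n → ℝ) → E}
    (hf : Continuous f) : IntegrableOn f (angleBox n) := by
  have hc : IsCompact (Set.univ.pi fun _ : Fin n => Set.Icc (-Real.pi) Real.pi) :=
    isCompact_univ_pi fun _ => isCompact_Icc
  exact (hf.continuousOn.integrableOn_compact hc).mono_set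
    (Set.pi_mono fun _ _ => Set.Ioc_subset_Icc_self)

lemma continuous_anchored {n : ℕ} (k : Fin (n + 1)) :
    Continuous fun θ : Fin n → ℝ => anchored θ k := by
  refine Fin.cases ?_ (fun i => ?_) k
  · simpa [anchored] using continuous_const
  · simpa [anchored] using continuous_apply i

lemma continuous_meanPhaseNorm (n : ℕ) : Continuous (meanPhaseNorm (n := n)) := by
  have := continuous_anchored (n := n)
  unfold meanPhaseNorm
  fun_prop

lemma meanPhaseNorm_nonneg {n : ℕ} (θ : Fin n → ℝ) : 0 ≤ meanPhaseNorm θ := by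
  unfold meanPhaseNorm
  positivity

lemma meanPhaseNorm_le_one {n : ℕ} (θ : Fin n → ℝ) : meanPhaseNorm θ ≤ 1 := by
  rw [meanPhaseNorm, div_le_one (by positivity)]
  refine (norm_sum_le _ _).trans ?_
  simp [Complex.norm_exp_ofReal_mul_I]

lemma integral_exp_int_mul_angle (m : ℤ) :
    ∫ x in Set.Ioc (-Real.pi) Real.pi, Complex.exp (((m : ℝ) * x : ℝ) * Complex.I) =
      if m = 0 then ((2 * Real.pi : ℝ) : ℂ) else 0 := by
  rw [← intervalIntegral.integral_of_le (by linarith [Real.pi_pos])]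
  split_ifs with h
  · subst h
    simp [two_mul]
  · have hc : (m : ℂ) * Complex.I ≠ 0 :=
      mul_ne_zero (Int.cast_ne_zero.mpr h) Complex.I_ne_zero
    have he : ∀ x : ℝ, Complex.exp (((m : ℝ) * x : ℝ) * Complex.I) =
        Complex.exp ((m : ℂ) * Complex.I * x) := fun x => by push_cast; ring_nf
    simp_rw [he]
    rw [integral_exp_mul_complex hc]
    have hp : Complex.exp ((m : ℂ) * Complex.I * (Real.pi : ℝ)) =
        Complex.exp ((m : ℂ) * Complex.I * ((-Real.pi : ℝ) : ℂ)) := by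
      rw [Complex.exp_eq_exp_iff_exists_int]
      exact ⟨m, by push_cast; ring⟩
    rw [hp, sub_self, zero_div]

/-- Orthogonality of the characters of the torus. -/
lemma integral_angleBox_exp {n : ℕ} (m : Fin n → ℤ) :
    ∫ θ in angleBox n, Complex.exp (((∑ k, (m k : ℝ) * θ k : ℝ) : ℂ) * Complex.I) =
      if ∀ k, m k = 0 then (((2 * Real.pi) ^ n : ℝ) : ℂ) else 0 := by
  have he : ∀ θ : Fin n → ℝ, Complex.exp (((∑ k, (m k : ℝ) * θ k : ℝ) : ℂ) * Complex.I) =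
      ∏ k, Complex.exp (((m k : ℝ) * θ k : ℝ) * Complex.I) := fun θ => by
    rw [← Complex.exp_sum, ← Finset.sum_mul, Complex.ofReal_sum]
  simp_rw [he]
  rw [angleBox, volume_pi, Measure.restrict_pi_pi,
    integral_fintype_prod_eq_prod
      (fun k (x : ℝ) => Complex.exp (((m k : ℝ) * x : ℝ) * Complex.I))]
  simp_rw [integral_exp_int_mul_angle]
  split_ifs with h
  · simp [h]
  · push Not at h
    obtain ⟨k, hk⟩ := h
    exact Finset.prod_eq_zero (Finset.mem_univ k) (if_neg hk)

lemma sum_colourDrift_mul {p n : ℕ} (a : Fin p → Fin 2) (b : Fin p → Fin (n + 1))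
    (θ : Fin n → ℝ) :
    ∑ k : Fin n, (colourDrift a b k.succ : ℝ) * θ k =
      ∑ y, ((((a (finRotate p y) : ℕ) : ℝ) - ((a y : ℕ) : ℝ)) * anchored θ (b y)) := by
  have h0 : ∑ k : Fin n, (colourDrift a b k.succ : ℝ) * θ k =
      ∑ k : Fin (n + 1), (colourDrift a b k : ℝ) * anchored θ k := by
    rw [Fin.sum_univ_succ]
    simp [anchored]
  rw [h0]
  unfold colourDrift
  push_cast
  simp_rw [Finset.sum_mul]
  rw [Finset.sum_comm]
  refine Finset.sum_congr rfl fun y _ => ?_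
  simp [ite_mul]

/-- Summing over the colours turns the sum over binary words into the trace of the power of the
matrix `!![N, φ; conj φ, N]`, where `φ` is the sum of the phases. -/
lemma sum_exp_drift {m n : ℕ} (θ : Fin n → ℝ) :
    ∑ a : Fin (m + 1) → Fin 2, ∑ b : Fin (m + 1) → Fin (n + 1),
        Complex.exp (((∑ k, (colourDrift a b k.succ : ℝ) * θ k : ℝ) : ℂ) * Complex.I) =
      (((n + 1 : ℕ) ^ (m + 1) *
        ((1 + meanPhaseNorm θ) ^ (m + 1) + (1 - meanPhaseNorm θ) ^ (m + 1)) : ℝ) : ℂ) := by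
  set φ : ℂ := ∑ k, Complex.exp (anchored θ k * Complex.I) with hφ
  have hconj : (starRingEnd ℂ) φ = ∑ k, Complex.exp (-(anchored θ k * Complex.I)) := by
    rw [hφ, map_sum]
    refine Finset.sum_congr rfl fun k _ => ?_
    rw [← Complex.exp_conj]
    simp
  have hr : ((‖φ‖ : ℝ) : ℂ) = ((n + 1 : ℕ) : ℂ) * (meanPhaseNorm θ : ℂ) := by
    rw [meanPhaseNorm, ← hφ]
    have : ((n + 1 : ℕ) : ℂ) ≠ 0 := Nat.cast_ne_zero.mpr n.succ_ne_zero
    push_cast at this ⊢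
    field_simp
  have hT : ∀ i j : Fin 2, ∑ k, Complex.exp
      ((((((j : ℕ) : ℝ) - ((i : ℕ) : ℝ)) * anchored θ k : ℝ) : ℂ) * Complex.I) =
      (!![((n + 1 : ℕ) : ℂ), φ; (starRingEnd ℂ) φ, ((n + 1 : ℕ) : ℂ)]) i j := by
    intro i j
    -- The increment `j - i` is `0` on the diagonal and `± 1` off it.
    fin_cases i <;> fin_cases j <;> simp [hconj, ← hφ]
  have hb : ∀ a : Fin (m + 1) → Fin 2, ∑ b : Fin (m + 1) → Fin (n + 1),
      Complex.exp (((∑ k, (colourDrift a b k.succ : ℝ) * θ k : ℝ) : ℂ) * Complex.I) =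
      ∏ y, (!![((n + 1 : ℕ) : ℂ), φ; (starRingEnd ℂ) φ, ((n + 1 : ℕ) : ℂ)])
        (a y) (a (finRotate (m + 1) y)) := by
    intro a
    simp_rw [← hT, sum_colourDrift_mul]
    rw [Fintype.prod_sum]
    refine Finset.sum_congr rfl fun b _ => ?_
    rw [← Complex.exp_sum, ← Finset.sum_mul, Complex.ofReal_sum]
  simp_rw [hb]
  rw [sum_prod_cycle_eq_trace, trace_pow_fin_two _ _ _ (‖φ‖ : ℂ) (Complex.mul_conj' φ), hr]
  push_cast
  rw [mul_add, ← mul_pow, ← mul_pow]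
  ring

/-- The solutions are counted by integrating the characters of their drifts over the torus. -/
lemma card_cyclicPairs_mul (m n : ℕ) :
    ((cyclicPairs (m + 1) 2 (n + 1)).card : ℝ) * (2 * Real.pi) ^ n =
      ∫ θ in angleBox n, ((n + 1 : ℕ) : ℝ) ^ (m + 1) *
        ((1 + meanPhaseNorm θ) ^ (m + 1) + (1 - meanPhaseNorm θ) ^ (m + 1)) := by
  apply Complex.ofReal_injective
  rw [← integral_complex_ofReal]
  simp_rw [← sum_exp_drift]
  have hint : ∀ (a : Fin (m + 1) → Fin 2) (b : Fin (m + 1) → Fin (n + 1)),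
      Integrable (fun θ : Fin n → ℝ =>
        Complex.exp (((∑ k, (colourDrift a b k.succ : ℝ) * θ k : ℝ) : ℂ) * Complex.I))
        (volume.restrict (angleBox n)) := fun a b =>
    integrableOn_angleBox (by fun_prop)
  rw [integral_finsetSum _ fun a _ => integrable_finsetSum _ fun b _ => hint a b]
  simp_rw [integral_finsetSum _ fun b _ => hint _ b, integral_angleBox_exp,
    ← mem_cyclicPairs_iff_succ]
  rw [← Fintype.sum_prod_type', Finset.sum_ite_mem, Finset.univ_inter, Finset.sum_const,
    nsmul_eq_mul]
  push_cast
  ring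

lemma limitMoment_eq_integral {p : ℕ} (hp : p ≠ 0) (n : ℕ) :
    limitMoment p 2 (n + 1) = ((2 * Real.pi) ^ n)⁻¹ *
      ∫ θ in angleBox n,
        (((1 + meanPhaseNorm θ) / 2) ^ p + ((1 - meanPhaseNorm θ) / 2) ^ p) := by
  obtain ⟨m, rfl⟩ := Nat.exists_eq_succ_of_ne_zero hp
  have h := card_cyclicPairs_mul m n
  rw [integral_const_mul] at h
  have hN : ((n + 1 : ℕ) : ℝ) ≠ 0 := by positivity
  have hpi : (2 * Real.pi) ^ n ≠ 0 := by positivity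
  simp_rw [div_pow, ← add_div]
  rw [integral_div, limitMoment, mul_pow, eq_div_of_mul_eq hpi h]
  push_cast at hN ⊢
  field_simp

/-! ### A degenerate Gaussian integral -/

/-- The sum of the squared differences of the angles, over all ordered pairs of colours. -/
noncomputable def pairSpread {n : ℕ} (x : Fin n → ℝ) : ℝ :=
  ∑ j, ∑ k, (anchored x j - anchored x k) ^ 2

/-- The parallel axis identity: the second moment about `t` is the one about the mean plus the
squared distance of `t` from the mean. -/
lemma sum_anchored_sub_sq {n : ℕ} (x : Fin n → ℝ) (t : ℝ) :
    ∑ k, (anchored x k - t) ^ 2 = pairSpread x / (2 * (n + 1 : ℕ)) +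
      (n + 1 : ℕ) * (t - (∑ k, anchored x k) / (n + 1 : ℕ)) ^ 2 := by
  have hN : ((n + 1 : ℕ) : ℝ) ≠ 0 := by positivity
  set y := anchored x
  set s := ∑ k, y k with hs
  set q := ∑ k, y k ^ 2 with hq
  have h1 : ∑ k, (y k - t) ^ 2 = q - 2 * t * s + (n + 1 : ℕ) * t ^ 2 := by
    simp_rw [sub_sq]
    rw [Finset.sum_add_distrib, Finset.sum_sub_distrib, ← Finset.sum_mul, ← Finset.mul_sum]
    simp only [Finset.sum_const, Finset.card_univ, Fintype.card_fin, nsmul_eq_mul, ← hs, ← hq]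
    ring
  have h2 : pairSpread x = 2 * (n + 1 : ℕ) * q - 2 * s ^ 2 := by
    have : ∀ j, ∑ k, (y j - y k) ^ 2 = (n + 1 : ℕ) * y j ^ 2 - 2 * y j * s + q := fun j => by
      simp_rw [sub_sq]
      rw [Finset.sum_add_distrib, Finset.sum_sub_distrib, ← Finset.mul_sum]
      simp [← hs, ← hq]
    unfold pairSpread
    simp_rw [show anchored x = y from rfl, this]
    rw [Finset.sum_add_distrib, Finset.sum_sub_distrib, ← Finset.sum_mul, ← Finset.mul_sum,
      ← Finset.mul_sum]
    simp only [Finset.sum_const, Finset.card_univ, Fintype.card_fin, nsmul_eq_mul, ← hs, ← hq]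
    ring
  rw [h1, h2]
  field_simp
  ring

lemma exp_neg_sum_anchored {n : ℕ} (c t : ℝ) (x : Fin n → ℝ) :
    Real.exp (-c * ∑ k, (anchored x k - t) ^ 2) =
      Real.exp (-c * t ^ 2) * ∏ k, Real.exp (-c * (x k - t) ^ 2) := by
  rw [Fin.sum_univ_succ, mul_add, Real.exp_add, Finset.mul_sum, Real.exp_sum]
  simp [anchored]

lemma integral_exp_neg_sum_anchored {n : ℕ} (c t : ℝ) :
    ∫ x : Fin n → ℝ, Real.exp (-c * ∑ k, (anchored x k - t) ^ 2) =
      Real.exp (-c * t ^ 2) * √(Real.pi / c) ^ n := by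
  simp_rw [exp_neg_sum_anchored]
  rw [integral_const_mul,
    integral_fintype_prod_volume_eq_pow (fun u : ℝ => Real.exp (-c * (u - t) ^ 2)),
    integral_sub_right_eq_self (fun u : ℝ => Real.exp (-c * u ^ 2)), integral_gaussian,
    Fintype.card_fin]

lemma integrable_exp_neg_sum_anchored {n : ℕ} {c : ℝ} (hc : 0 < c) :
    Integrable (fun z : (Fin n → ℝ) × ℝ => Real.exp (-c * ∑ k, (anchored z.1 k - z.2) ^ 2))
      (volume.prod volume) := by
  have hcont : Continuous
      (fun z : (Fin n → ℝ) × ℝ => Real.exp (-c * ∑ k, (anchored z.1 k - z.2) ^ 2)) := by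
    have : ∀ k, Continuous fun z : (Fin n → ℝ) × ℝ => anchored z.1 k :=
      fun k => (continuous_anchored k).comp continuous_fst
    fun_prop
  rw [integrable_prod_iff' hcont.aestronglyMeasurable]
  constructor
  · refine Eventually.of_forall fun t => ?_
    simp_rw [exp_neg_sum_anchored]
    exact (Integrable.fintype_prod (f := fun _ (u : ℝ) => Real.exp (-c * (u - t) ^ 2))
      fun _ => (integrable_exp_neg_mul_sq hc).comp_sub_right t).const_mul _
  · simp_rw [Real.norm_eq_abs, Real.abs_exp, integral_exp_neg_sum_anchored]
    exact (integrable_exp_neg_mul_sq hc).mul_const _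

/-- The quadratic form `pairSpread` is diagonalised by an auxiliary Gaussian variable `t` in the
role of the mean: integrating over `t` first gives the left-hand side, and integrating over `x`
first gives a product of one-dimensional Gaussian integrals. -/
lemma integral_exp_neg_pairSpread {n : ℕ} {c : ℝ} (hc : 0 < c) :
    ∫ x : Fin n → ℝ, Real.exp (-c * (pairSpread x / (2 * (n + 1 : ℕ)))) =
      √(Real.pi / c) ^ n * √((n + 1 : ℕ) : ℝ) := by
  have hN : (0 : ℝ) < (n + 1 : ℕ) := by positivity
  have hswap := integral_integral_swap
    (f := fun (x : Fin n → ℝ) (t : ℝ) => Real.exp (-c * ∑ k, (anchored x k - t) ^ 2))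
    (integrable_exp_neg_sum_anchored hc)
  simp_rw [integral_exp_neg_sum_anchored] at hswap
  rw [integral_mul_const, integral_gaussian] at hswap
  have hin : ∀ x : Fin n → ℝ, ∫ t : ℝ, Real.exp (-c * ∑ k, (anchored x k - t) ^ 2) =
      Real.exp (-c * (pairSpread x / (2 * (n + 1 : ℕ)))) *
        √(Real.pi / (c * (n + 1 : ℕ))) := fun x => by
    simp_rw [sum_anchored_sub_sq, mul_add, Real.exp_add, ← mul_assoc, neg_mul c _]
    rw [integral_const_mul,
      integral_sub_right_eq_self
        (fun u : ℝ => Real.exp (-(c * (n + 1 : ℕ)) * u ^ 2)), integral_gaussian]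
  simp_rw [hin] at hswap
  rw [integral_mul_const] at hswap
  have hs : √(Real.pi / c) = √(Real.pi / (c * (n + 1 : ℕ))) * √((n + 1 : ℕ) : ℝ) := by
    rw [← Real.sqrt_mul (by positivity)]
    congr 1
    field_simp
  have hne : √(Real.pi / (c * (n + 1 : ℕ))) ≠ 0 :=
    (Real.sqrt_pos.mpr (by positivity)).ne'
  apply mul_right_cancel₀ hne
  rw [hswap]
  nth_rewrite 1 [hs]
  ring

/-! ### Behaviour of the mean phase near the origin -/

lemma one_sub_meanPhaseNorm_sq {n : ℕ} (θ : Fin n → ℝ) :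
    1 - meanPhaseNorm θ ^ 2 =
      (∑ j, ∑ k, (1 - Real.cos (anchored θ j - anchored θ k))) / ((n + 1 : ℕ) : ℝ) ^ 2 := by
  have hN : ((n + 1 : ℕ) : ℝ) ≠ 0 := by positivity
  have h : ‖∑ k, Complex.exp (anchored θ k * Complex.I)‖ ^ 2 =
      ∑ j, ∑ k, Real.cos (anchored θ j - anchored θ k) := by
    rw [Complex.sq_norm, Complex.normSq_apply, Complex.re_sum, Complex.im_sum]
    simp_rw [Complex.exp_ofReal_mul_I_re, Complex.exp_ofReal_mul_I_im, Real.cos_sub,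
      Finset.sum_add_distrib, Finset.sum_mul_sum]
  rw [meanPhaseNorm, div_pow, h]
  simp_rw [Finset.sum_sub_distrib]
  simp only [Finset.sum_const, Finset.card_univ, Fintype.card_fin, nsmul_eq_mul]
  field_simp

/-- On the box the phases cannot agree except at the origin; the pairs that contain the anchored
colour alone give a quadratic lower bound for `1 - r²`. -/
lemma half_one_add_meanPhaseNorm_le {n : ℕ} {θ : Fin n → ℝ} (hθ : θ ∈ angleBox n) :
    (1 + meanPhaseNorm θ) / 2 ≤
      Real.exp (-(1 / (2 * ((n + 1 : ℕ) : ℝ) ^ 2 * Real.pi ^ 2)) * ∑ k, θ k ^ 2) := by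
  have hN : (0 : ℝ) < (n + 1 : ℕ) := by positivity
  have hcos : ∀ k, 2 / Real.pi ^ 2 * θ k ^ 2 ≤ 1 - Real.cos (θ k) := fun k => by
    have := hθ k (Set.mem_univ k)
    have := Real.cos_le_one_sub_mul_cos_sq (abs_le.mpr ⟨this.1.le, this.2⟩)
    linarith
  have hsum : 2 / Real.pi ^ 2 * ∑ k, θ k ^ 2 ≤
      ∑ j, ∑ k, (1 - Real.cos (anchored θ j - anchored θ k)) := by
    have hnn : ∀ j k, 0 ≤ 1 - Real.cos (anchored θ j - anchored θ k) :=
      fun j k => sub_nonneg.mpr (Real.cos_le_one _)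
    refine le_trans ?_ (Finset.single_le_sum
      (f := fun j => ∑ k, (1 - Real.cos (anchored θ j - anchored θ k)))
      (fun j _ => Finset.sum_nonneg fun k _ => hnn j k) (Finset.mem_univ 0))
    rw [Fin.sum_univ_succ, Finset.mul_sum]
    refine le_add_of_nonneg_of_le (hnn _ _) (Finset.sum_le_sum fun k _ => ?_)
    simpa [anchored] using hcos k
  have hsq := one_sub_meanPhaseNorm_sq θ
  have hle : (2 / Real.pi ^ 2 * ∑ k, θ k ^ 2) / ((n + 1 : ℕ) : ℝ) ^ 2 ≤
      1 - meanPhaseNorm θ ^ 2 := by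
    rw [hsq]
    gcongr
  -- `r ≤ 1 - (1 - r²) / 2`, which is `0 ≤ (1 - r)²`, followed by `1 - s ≤ exp (-s)`.
  have hexp := Real.add_one_le_exp
    (-(1 / (2 * ((n + 1 : ℕ) : ℝ) ^ 2 * Real.pi ^ 2)) * ∑ k, θ k ^ 2)
  have hrw : (2 / Real.pi ^ 2 * ∑ k, θ k ^ 2) / ((n + 1 : ℕ) : ℝ) ^ 2 =
      4 * ((1 / (2 * ((n + 1 : ℕ) : ℝ) ^ 2 * Real.pi ^ 2)) * ∑ k, θ k ^ 2) := by
    field_simp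
    ring
  rw [hrw] at hle
  nlinarith [sq_nonneg (1 - meanPhaseNorm θ)]

lemma one_sub_cos_eq_sinc (z : ℝ) : 1 - Real.cos z = z ^ 2 / 2 * Real.sinc (z / 2) ^ 2 := by
  rcases eq_or_ne z 0 with rfl | hz
  · simp
  · rw [Real.sinc_of_ne_zero (by positivity), div_pow, Real.sin_sq_eq_half_sub]
    rw [mul_div_cancel₀ z two_ne_zero]
    field_simp

lemma tendsto_inv_sqrt_natCast : Tendsto (fun p : ℕ => (√(p : ℝ))⁻¹) atTop (𝓝 0) :=
  tendsto_inv_atTop_zero.comp (Real.tendsto_sqrt_atTop.comp tendsto_natCast_atTop_atTop)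

lemma tendsto_mul_one_sub_cos (u : ℝ) :
    Tendsto (fun p : ℕ => (p : ℝ) * (1 - Real.cos ((√(p : ℝ))⁻¹ * u))) atTop
      (𝓝 (u ^ 2 / 2)) := by
  have h : Tendsto (fun p : ℕ => u ^ 2 / 2 * Real.sinc ((√(p : ℝ))⁻¹ * u / 2) ^ 2) atTop
      (𝓝 (u ^ 2 / 2 * Real.sinc (0 * u / 2) ^ 2)) :=
    (((Real.continuous_sinc.tendsto _).comp
      ((tendsto_inv_sqrt_natCast.mul_const u).div_const 2)).pow 2).const_mul _
  rw [zero_mul, zero_div, Real.sinc_zero, one_pow, mul_one] at h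
  refine h.congr' ?_
  filter_upwards [eventually_gt_atTop 0] with p hp
  have hp' : (0 : ℝ) < p := Nat.cast_pos.mpr hp
  rw [one_sub_cos_eq_sinc, mul_pow, inv_pow, Real.sq_sqrt hp'.le]
  field_simp

lemma anchored_smul {n : ℕ} (c : ℝ) (x : Fin n → ℝ) (k : Fin (n + 1)) :
    anchored (c • x) k = c * anchored x k := by
  refine Fin.cases ?_ (fun i => ?_) k <;> simp [anchored]

lemma meanPhaseNorm_zero (n : ℕ) : meanPhaseNorm (0 : Fin n → ℝ) = 1 := by
  have h : ∀ k, anchored (0 : Fin n → ℝ) k = 0 := fun k => by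
    simpa using anchored_smul 0 (0 : Fin n → ℝ) k
  have : ((n : ℝ) + 1) ≠ 0 := by positivity
  have h' : ‖(n : ℂ) + 1‖ = (n : ℝ) + 1 := by
    exact_mod_cast Complex.norm_natCast (n + 1)
  simp [meanPhaseNorm, h, h', this]

lemma tendsto_inv_sqrt_smul {n : ℕ} (x : Fin n → ℝ) :
    Tendsto (fun p : ℕ => (√(p : ℝ))⁻¹ • x) atTop (𝓝 0) := by
  simpa using tendsto_inv_sqrt_natCast.smul_const x

/-- The Gaussian limit of the integrand on the scale `1 / √p`. -/
lemma tendsto_half_one_add_pow {n : ℕ} (x : Fin n → ℝ) :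
    Tendsto (fun p : ℕ => ((1 + meanPhaseNorm ((√(p : ℝ))⁻¹ • x)) / 2) ^ p) atTop
      (𝓝 (Real.exp (-(1 / (4 * (n + 1 : ℕ))) * (pairSpread x / (2 * (n + 1 : ℕ)))))) := by
  have hN : (0 : ℝ) < (n + 1 : ℕ) := by positivity
  have hr : Tendsto (fun p : ℕ => meanPhaseNorm ((√(p : ℝ))⁻¹ • x)) atTop (𝓝 1) := by
    rw [← meanPhaseNorm_zero n]
    exact ((continuous_meanPhaseNorm n).tendsto 0).comp (tendsto_inv_sqrt_smul x)
  have hV : Tendsto (fun p : ℕ => (p : ℝ) * (1 - meanPhaseNorm ((√(p : ℝ))⁻¹ • x) ^ 2)) atTop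
      (𝓝 ((∑ j, ∑ k, (anchored x j - anchored x k) ^ 2 / 2) / ((n + 1 : ℕ) : ℝ) ^ 2)) := by
    simp_rw [one_sub_meanPhaseNorm_sq, anchored_smul, ← mul_sub, ← mul_div_assoc, Finset.mul_sum]
    exact (tendsto_finsetSum _ fun j _ => tendsto_finsetSum _ fun k _ =>
      tendsto_mul_one_sub_cos _).div_const _
  have hlim := (hV.neg.div ((hr.const_add 1).const_mul 2) (by norm_num))
  have hval : -((∑ j, ∑ k, (anchored x j - anchored x k) ^ 2 / 2) / ((n + 1 : ℕ) : ℝ) ^ 2) /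
      (2 * (1 + 1)) = -(1 / (4 * (n + 1 : ℕ))) * (pairSpread x / (2 * (n + 1 : ℕ))) := by
    simp_rw [pairSpread, ← Finset.sum_div]
    field_simp
    ring
  rw [hval] at hlim
  -- `(r - 1) / 2 = -(1 - r²) / (2 (1 + r))`, where `1 + r` tends to `2`.
  have hg : Tendsto (fun p : ℕ => (p : ℝ) * ((meanPhaseNorm ((√(p : ℝ))⁻¹ • x) - 1) / 2)) atTop
      (𝓝 (-(1 / (4 * (n + 1 : ℕ))) * (pairSpread x / (2 * (n + 1 : ℕ))))) := by
    refine hlim.congr fun p => ?_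
    have hpos : 1 + meanPhaseNorm ((√(p : ℝ))⁻¹ • x) ≠ 0 :=
      (add_pos_of_pos_of_nonneg one_pos (meanPhaseNorm_nonneg _)).ne'
    rw [Pi.div_apply, div_eq_iff (mul_ne_zero two_ne_zero hpos)]
    ring
  refine (Real.tendsto_one_add_pow_exp_of_tendsto hg).congr fun p => ?_
  ring

/-! ### Laplace asymptotics of the integral -/

lemma integral_angleBox_scale {n p : ℕ} (hp : p ≠ 0) (f : (Fin n → ℝ) → ℝ) :
    √(p : ℝ) ^ n * ∫ θ in angleBox n, f θ =
      ∫ x, (angleBox n).indicator f ((√(p : ℝ))⁻¹ • x) := by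
  have hs : 0 < √(p : ℝ) := Real.sqrt_pos.mpr (by positivity)
  rw [Measure.integral_comp_smul, integral_indicator (measurableSet_angleBox n),
    Module.finrank_fin_fun, inv_pow, inv_inv, abs_of_pos (by positivity), smul_eq_mul]

lemma angleBox_mem_nhds (n : ℕ) : angleBox n ∈ 𝓝 (0 : Fin n → ℝ) :=
  set_pi_mem_nhds Set.finite_univ fun _ _ =>
    Ioc_mem_nhds (neg_lt_zero.mpr Real.pi_pos) Real.pi_pos

/-- Laplace's method: after the substitution `θ = x / √p` the integrand converges to a Gaussian and
is dominated, uniformly in `p`, by another one. -/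
lemma tendsto_sqrt_pow_mul_integral_add (n : ℕ) :
    Tendsto (fun p : ℕ => √(p : ℝ) ^ n *
        ∫ θ in angleBox n, ((1 + meanPhaseNorm θ) / 2) ^ p) atTop
      (𝓝 (√(4 * Real.pi * (n + 1 : ℕ)) ^ n * √((n + 1 : ℕ) : ℝ))) := by
  have hN : (0 : ℝ) < (n + 1 : ℕ) := by positivity
  have hG := integral_exp_neg_pairSpread (n := n) (c := 1 / (4 * (n + 1 : ℕ))) (by positivity)
  rw [show Real.pi / (1 / (4 * ((n + 1 : ℕ) : ℝ))) = 4 * Real.pi * (n + 1 : ℕ) by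
    field_simp] at hG
  rw [← hG]
  -- The constant of `half_one_add_meanPhaseNorm_le`.
  set c : ℝ := 1 / (2 * ((n + 1 : ℕ) : ℝ) ^ 2 * Real.pi ^ 2) with hc
  have hcpos : 0 < c := by positivity
  have hdct : Tendsto (fun p : ℕ => ∫ x, (angleBox n).indicator
      (fun θ => ((1 + meanPhaseNorm θ) / 2) ^ p) ((√(p : ℝ))⁻¹ • x)) atTop
      (𝓝 (∫ x : Fin n → ℝ,
        Real.exp (-(1 / (4 * (n + 1 : ℕ))) * (pairSpread x / (2 * (n + 1 : ℕ)))))) := by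
    refine tendsto_integral_filter_of_dominated_convergence
      (fun x => ∏ k, Real.exp (-c * x k ^ 2)) ?_ ?_ ?_ ?_
    · refine Eventually.of_forall fun p => ?_
      have hm : Measurable (fun θ : Fin n → ℝ => ((1 + meanPhaseNorm θ) / 2) ^ p) := by
        have := continuous_meanPhaseNorm n
        exact Continuous.measurable (by fun_prop)
      exact ((hm.indicator (measurableSet_angleBox n)).comp
        (measurable_const_smul _)).aestronglyMeasurable
    · filter_upwards [eventually_gt_atTop 0] with p hp
      refine Eventually.of_forall fun x => ?_
      have hp' : (0 : ℝ) < p := Nat.cast_pos.mpr hp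
      by_cases hx : (√(p : ℝ))⁻¹ • x ∈ angleBox n
      · have hnn := meanPhaseNorm_nonneg ((√(p : ℝ))⁻¹ • x)
        rw [Set.indicator_of_mem hx, Real.norm_of_nonneg (by positivity)]
        refine (pow_le_pow_left₀ (by positivity) (half_one_add_meanPhaseNorm_le hx) p).trans_eq ?_
        rw [← Real.exp_nat_mul, ← Real.exp_sum, ← Finset.mul_sum, ← hc]
        congr 1
        simp only [Pi.smul_apply, smul_eq_mul, mul_pow, inv_pow, Real.sq_sqrt hp'.le]
        rw [← Finset.mul_sum]
        field_simp
      · rw [Set.indicator_of_notMem hx, norm_zero]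
        exact Finset.prod_nonneg fun _ _ => (Real.exp_pos _).le
    · exact Integrable.fintype_prod (f := fun _ (u : ℝ) => Real.exp (-c * u ^ 2))
        fun _ => integrable_exp_neg_mul_sq hcpos
    · refine Eventually.of_forall fun x => ?_
      refine (tendsto_half_one_add_pow x).congr' ?_
      filter_upwards [(tendsto_inv_sqrt_smul x).eventually (angleBox_mem_nhds n)] with p hp
      rw [Set.indicator_of_mem hp]
  refine hdct.congr' ?_
  filter_upwards [eventually_ne_atTop 0] with p hp
  rw [integral_angleBox_scale hp]

/-- The smaller eigenvalue contributes an exponentially small amount. -/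
lemma tendsto_sqrt_pow_mul_integral_sub (n : ℕ) :
    Tendsto (fun p : ℕ => √(p : ℝ) ^ n *
        ∫ θ in angleBox n, ((1 - meanPhaseNorm θ) / 2) ^ p) atTop (𝓝 0) := by
  have hz : Tendsto (fun p : ℕ => (p : ℝ) ^ n * (1 / 2 : ℝ) ^ p * volume.real (angleBox n))
      atTop (𝓝 0) := by
    simpa using (tendsto_pow_const_mul_const_pow_of_abs_lt_one n
      (show |(1 / 2 : ℝ)| < 1 by norm_num [abs_of_pos])).mul_const (volume.real (angleBox n))
  refine squeeze_zero_norm' ?_ hz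
  filter_upwards [eventually_ge_atTop 1] with p hp
  have hp1 : (1 : ℝ) ≤ p := Nat.one_le_cast.mpr hp
  rw [norm_mul, mul_assoc]
  refine mul_le_mul ?_ ?_ (norm_nonneg _) (by positivity)
  · rw [norm_pow, Real.norm_of_nonneg (Real.sqrt_nonneg _)]
    exact pow_le_pow_left₀ (Real.sqrt_nonneg _)
      (Real.sqrt_le_iff.mpr ⟨by positivity, by nlinarith⟩) n
  · refine norm_setIntegral_le_of_norm_le_const (volume_angleBox_lt_top n) fun θ _ => ?_
    have h0 := meanPhaseNorm_nonneg θ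
    have h1 := meanPhaseNorm_le_one θ
    rw [norm_pow]
    refine pow_le_pow_left₀ (norm_nonneg _) ?_ p
    rw [Real.norm_of_nonneg (by linarith)]
    linarith

lemma tendsto_sqrt_pow_mul_limitMoment (n : ℕ) :
    Tendsto (fun p : ℕ => √(p : ℝ) ^ n * limitMoment p 2 (n + 1)) atTop
      (𝓝 (√(((n + 1 : ℕ) : ℝ) ^ (n + 1) / Real.pi ^ n))) := by
  have h := ((tendsto_sqrt_pow_mul_integral_add n).add
    (tendsto_sqrt_pow_mul_integral_sub n)).const_mul ((2 * Real.pi) ^ n)⁻¹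
  have hval : ((2 * Real.pi) ^ n)⁻¹ *
      (√(4 * Real.pi * (n + 1 : ℕ)) ^ n * √((n + 1 : ℕ) : ℝ) + 0) =
      √(((n + 1 : ℕ) : ℝ) ^ (n + 1) / Real.pi ^ n) := by
    have hsq : (√(4 * Real.pi * (n + 1 : ℕ)) ^ n) ^ 2 = (4 * Real.pi * (n + 1 : ℕ)) ^ n := by
      rw [← pow_mul, mul_comm n 2, pow_mul, Real.sq_sqrt (by positivity)]
    have h4 : ((2 : ℝ) ^ n) ^ 2 = 4 ^ n := by
      rw [← pow_mul, mul_comm n 2, pow_mul]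
      norm_num
    symm
    rw [Real.sqrt_eq_iff_mul_self_eq (by positivity) (by positivity), add_zero, ← sq,
      mul_pow _ _ 2, mul_pow _ _ 2, hsq, Real.sq_sqrt (by positivity), inv_pow, mul_pow 2, mul_pow,
      h4, mul_pow, mul_pow, pow_succ]
    field_simp
  rw [hval] at h
  refine h.congr' ?_
  filter_upwards [eventually_ne_atTop 0] with p hp
  have hcont := continuous_meanPhaseNorm n
  rw [limitMoment_eq_integral hp, integral_add (integrableOn_angleBox (by fun_prop))
    (integrableOn_angleBox (by fun_prop))]
  ring

theorem theorem6p4 (N : ℕ) (hN : 1 ≤ N) :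
    Filter.Tendsto
      (fun p : ℕ =>
        limitMoment p 2 N / Real.sqrt ((N : ℝ) ^ N / (Real.pi * (p : ℝ)) ^ (N - 1)))
      Filter.atTop (nhds 1) := by
  obtain ⟨n, rfl⟩ := Nat.exists_eq_add_of_le' hN
  have hpos : 0 < √(((n + 1 : ℕ) : ℝ) ^ (n + 1) / Real.pi ^ n) :=
    Real.sqrt_pos.mpr (by positivity)
  have h := (tendsto_sqrt_pow_mul_limitMoment n).div_const
    (√(((n + 1 : ℕ) : ℝ) ^ (n + 1) / Real.pi ^ n))
  rw [div_self hpos.ne'] at h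
  refine h.congr' ?_
  filter_upwards [eventually_ne_atTop 0] with p hp
  have hs : √(p : ℝ) ^ n ≠ 0 := pow_ne_zero _ (Real.sqrt_pos.mpr (by positivity)).ne'
  have he : √(((n + 1 : ℕ) : ℝ) ^ (n + 1) / (Real.pi * (p : ℝ)) ^ (n + 1 - 1)) =
      √(((n + 1 : ℕ) : ℝ) ^ (n + 1) / Real.pi ^ n) / √(p : ℝ) ^ n := by
    have hsp : √((p : ℝ) ^ n) = √(p : ℝ) ^ n := by
      rw [Real.sqrt_eq_iff_mul_self_eq (by positivity) (by positivity), ← mul_pow,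
        Real.mul_self_sqrt (by positivity)]
    rw [Nat.add_sub_cancel, mul_pow, ← div_div, Real.sqrt_div (by positivity), hsp]
  rw [he]
  field_simp
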